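/- Let $G$ be a finite simple connected graph with diameter $2$ which is distance-regular, i.e. for all vertices $u,v$ and all $i,j$ the number of vertices at distance $i$ from $u$ and distance $j$ from $v$ depends only on $i$, $j$ and $\operatorname{dist}_G(u,v)$. Let $\mathcal A$ be the set of arcs of $G$ (two arcs $(x,y)$ and $(y,x)$ for each edge $xy$). Define the matrices $S\in\mathbb C^{\mathcal A\times\mathcal A}$ with $S_{ab}=1$ if $a$ is the reverse of $b$ and $0$ otherwise; $N\in\mathbb C^{V(G)\times\mathcal A}$ with $N_{ua}=1/\sqrt{\deg u}$ if the arc $a$ ends at $u$ and $0$ otherwise; and $U=S(2N^*N-I)$, the time evolution matrix of the Grover walk on $G$. For a vertex $u$ with unit vector $\mathbf e_u\in\mathbb C^{V(G)}$ put $\Phi_u=N^*\mathbf e_u$. One says that $G$ exhibits perfect state transfer if there are distinct vertices $u,v$, a positive integer $\tau$ and $\gamma\in\mathbb C$ with $|\gamma|=1$ such that $U^\tau\Phi_u=\gamma\Phi_v$. Then $G$ exhibits perfect state transfer if and only if $G$ is isomorphic to the cycle $C_4$ or to the complete tripartite graph $K_{2,2,2}$. -/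

import Mathlib

open scoped Matrix

noncomputable section

namespace GroverWalk

variable {V : Type*} [Fintype V]

/-- A finite graph is distance-regular if it is connected and, for all vertices `u`, `v`, the number
of vertices at distance `i` from `u` and `j` from `v` depends only on `i`, `j` and `dist u v`. -/
def IsDistanceRegular (G : SimpleGraph V) : Prop :=
  G.Connected ∧ ∀ (i j : ℕ) (u v u' v' : V), G.dist u v = G.dist u' v' →
    (Finset.univ.filter (fun w => G.dist u w = i ∧ G.dist v w = j)).card =
      (Finset.univ.filter (fun w => G.dist u' w = i ∧ G.dist v' w = j)).card

variable [DecidableEq V] (G : SimpleGraph V) [DecidableRel G.Adj]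

/-- The shift matrix, indexed by the arcs (darts) of `G`: `S a b = 1` if `a = b⁻¹`, else `0`. -/
def shift : Matrix G.Dart G.Dart ℂ :=
  Matrix.of fun a b => if a = b.symm then 1 else 0

/-- The boundary matrix: `N u a = 1 / √(deg u)` if `u` is the terminus of `a`, else `0`. -/
def boundary : Matrix V G.Dart ℂ :=
  Matrix.of fun u a => if u = a.snd then 1 / ((Real.sqrt (G.degree u : ℝ) : ℝ) : ℂ) else 0

/-- The coin matrix `K = 2 N* N - I`. -/
def coin : Matrix G.Dart G.Dart ℂ :=
  (2 : ℂ) • ((boundary G)ᴴ * boundary G) - 1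

/-- The time evolution matrix `U = S K` of the Grover walk on `G`. -/
def evolution : Matrix G.Dart G.Dart ℂ :=
  shift G * coin G

/-- The vertex-type state `Φ_u = N* e_u`. -/
def vertexState (u : V) : G.Dart → ℂ :=
  (boundary G)ᴴ *ᵥ Pi.single u 1

/-- Perfect state transfer from `u` to another vertex `v` at the positive time `τ`. -/
def PSTBetween (u v : V) (τ : ℕ) : Prop :=
  u ≠ v ∧ 0 < τ ∧
    ∃ γ : ℂ, ‖γ‖ = 1 ∧ (evolution G ^ τ) *ᵥ vertexState G u = γ • vertexState G v

/-- `G` exhibits (Grover) perfect state transfer. -/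
def HasPST : Prop :=
  ∃ (u v : V) (τ : ℕ), PSTBetween G u v τ

end GroverWalk

end

open scoped Matrix ComplexOrder
open Polynomial

namespace GroverWalk

/-! ### Grover walk and its compression to the vertex space -/

section Walk

variable {V : Type*} [Fintype V] [DecidableEq V] (G : SimpleGraph V) [DecidableRel G.Adj]

/-! Compressing the walk to the vertices gives `N U^n N* = T_n(P)`, with `T_n` the Chebyshev
polynomial and `P = N S N*` the normalized adjacency matrix. Transfer from `u` to `v` thus makes
column `u` of `T_n(P)` equal to `γ e_v`.

By distance-regularity, entries of polynomials in `P` depend only on distance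
(`aeval_discriminant_apply_eq`), so `v` is the only vertex at its distance from `u`. Degrees are at
least 2, so this distance is 2, `G` is a cocktail party graph, and `T_n(P) = γ • pairing σ`. The
eigenvalue 1 gives `γ = 1`, and then `-2/k` gives `T_n(-2/k) = 1`. Hence `arccos(-2/k)` is a
rational multiple of `π`, and Niven's theorem leaves `k = 2` or `k = 4`.

Conversely, `T_2(P)` for `C_4` and `T_6(P)` for `K_{2,2,2}` equal the pairing matrix; it is unitary,
so the compressed identity lifts to the walk. -/

theorem shift_mul_shift : shift G * shift G = 1 := by
  ext a b
  simp only [Matrix.mul_apply, shift, Matrix.of_apply, Matrix.one_apply, mul_ite, mul_one, mul_zero]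
  rw [Finset.sum_eq_single b.symm (fun c _ hc => by simp [hc]) (by simp)]
  simp

omit [Fintype V] [DecidableRel G.Adj] in
theorem shift_conjTranspose : (shift G)ᴴ = shift G := by
  ext a b
  have : b = a.symm ↔ a = b.symm :=
    ⟨fun h => by simp [h], fun h => by simp [h]⟩
  simp only [Matrix.conjTranspose_apply, shift, Matrix.of_apply, this]
  split_ifs <;> simp

theorem boundary_conjTranspose_apply (a : G.Dart) (u : V) :
    (boundary G)ᴴ a u = boundary G u a := by
  simp only [Matrix.conjTranspose_apply, boundary, Matrix.of_apply]
  split_ifs <;> simp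

omit [DecidableEq V] in
theorem sum_dart {M : Type*} [AddCommMonoid M] (f : V → V → M) :
    ∑ a : G.Dart, f a.fst a.snd = ∑ x, ∑ y, if G.Adj x y then f x y else 0 := by
  rw [← Finset.sum_product', ← Finset.sum_filter]
  refine Finset.sum_bij (fun a _ => a.toProd) (fun a _ => by simp)
    (fun a _ b _ h => SimpleGraph.Dart.ext a b h) (fun p hp => ?_) (fun a _ => rfl)
  exact ⟨⟨p, by simpa using hp⟩, by simp, rfl⟩

theorem boundary_mul_conjTranspose (h : ∀ v, G.degree v ≠ 0) :
    boundary G * (boundary G)ᴴ = 1 := by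
  ext u w
  simp only [Matrix.mul_apply, boundary_conjTranspose_apply]
  simp only [boundary, Matrix.of_apply]
  rw [sum_dart G (fun _ y => (if u = y then 1 / ((Real.sqrt (G.degree u : ℝ) : ℝ) : ℂ) else 0) *
    (if w = y then 1 / ((Real.sqrt (G.degree w : ℝ) : ℝ) : ℂ) else 0)), Finset.sum_comm]
  rw [Finset.sum_eq_single u (fun y _ hy => by simp [hy.symm]) (by simp)]
  by_cases huw : u = w
  · subst huw
    have hd : (G.degree u : ℂ) ≠ 0 := by exact_mod_cast h u
    have hs : ((Real.sqrt (G.degree u : ℝ) : ℝ) : ℂ) * ((Real.sqrt (G.degree u : ℝ) : ℝ) : ℂ)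
        = G.degree u := by
      rw [← Complex.ofReal_mul, Real.mul_self_sqrt (Nat.cast_nonneg _)]; simp
    rw [← Finset.sum_filter, Finset.sum_const]
    have : (Finset.univ.filter fun x => G.Adj x u).card = G.degree u := by
      rw [← G.card_neighborFinset_eq_degree]
      congr 1; ext x; simp [G.adj_comm]
    rw [this]
    simp only [if_true, nsmul_eq_mul, Matrix.one_apply_eq]
    rw [div_mul_div_comm, hs]
    field_simp
  · simp [Ne.symm huw, Matrix.one_apply_ne huw]

/-- The discriminant `N S N*` of the Grover walk. -/
noncomputable def discriminant : Matrix V V ℂ :=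
  boundary G * shift G * (boundary G)ᴴ

theorem discriminant_apply (u w : V) : discriminant G u w =
    if G.Adj u w then 1 / ((Real.sqrt (G.degree u : ℝ) : ℝ) : ℂ) *
      (1 / ((Real.sqrt (G.degree w : ℝ) : ℝ) : ℂ)) else 0 := by
  have h1 : ∀ b : G.Dart, (boundary G * shift G) u b = boundary G u b.symm := by
    intro b
    simp only [Matrix.mul_apply, shift, Matrix.of_apply, mul_ite, mul_one, mul_zero]
    simp
  rw [discriminant, Matrix.mul_apply]
  simp only [h1, boundary_conjTranspose_apply]
  simp only [boundary, Matrix.of_apply, SimpleGraph.Dart.symm_toProd, Prod.snd_swap]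
  rw [sum_dart G (fun x y => (if u = x then 1 / ((Real.sqrt (G.degree u : ℝ) : ℝ) : ℂ) else 0) *
    (if w = y then 1 / ((Real.sqrt (G.degree w : ℝ) : ℝ) : ℂ) else 0))]
  rw [Finset.sum_eq_single u (fun y _ hy => by simp [hy.symm]) (by simp)]
  rw [Finset.sum_eq_single w (fun y _ hy => by simp [hy.symm]) (by simp)]
  simp

theorem discriminant_apply_of_regular {k : ℕ} (hk : ∀ v, G.degree v = k) (u w : V) :
    discriminant G u w = if G.Adj u w then (k : ℂ)⁻¹ else 0 := by
  rw [discriminant_apply, hk, hk, div_mul_div_comm, ← Complex.ofReal_mul,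
    Real.mul_self_sqrt (Nat.cast_nonneg _)]
  simp

variable {G}

theorem coin_mul_conjTranspose (h : ∀ v, G.degree v ≠ 0) :
    coin G * (boundary G)ᴴ = (boundary G)ᴴ := by
  rw [coin, Matrix.sub_mul, Matrix.smul_mul, Matrix.mul_assoc, boundary_mul_conjTranspose G h,
    Matrix.mul_one, Matrix.one_mul, two_smul, add_sub_cancel_right]

theorem coin_mul_coin (h : ∀ v, G.degree v ≠ 0) : coin G * coin G = 1 := by
  conv_lhs => enter [2]; rw [coin]
  rw [mul_sub, Matrix.mul_smul, ← Matrix.mul_assoc, coin_mul_conjTranspose h, coin]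
  simp

theorem coin_conjTranspose : (coin G)ᴴ = coin G := by
  rw [coin, Matrix.conjTranspose_sub, Matrix.conjTranspose_smul, Matrix.conjTranspose_mul]
  simp

theorem evolution_conjTranspose_mul (h : ∀ v, G.degree v ≠ 0) :
    (evolution G)ᴴ * evolution G = 1 := by
  rw [evolution, Matrix.conjTranspose_mul, shift_conjTranspose, coin_conjTranspose,
    Matrix.mul_assoc, ← Matrix.mul_assoc (shift G), shift_mul_shift, Matrix.one_mul,
    coin_mul_coin h]

theorem evolution_pow_conjTranspose_mul (h : ∀ v, G.degree v ≠ 0) (n : ℕ) :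
    (evolution G ^ n)ᴴ * evolution G ^ n = 1 := by
  induction n with
  | zero => simp
  | succ n ih =>
    rw [pow_succ, Matrix.conjTranspose_mul, Matrix.mul_assoc, ← Matrix.mul_assoc _ᴴ _ (evolution G),
      ih, Matrix.one_mul, evolution_conjTranspose_mul h]

theorem evolution_mul_conjTranspose (h : ∀ v, G.degree v ≠ 0) :
    evolution G * (boundary G)ᴴ = shift G * (boundary G)ᴴ := by
  rw [evolution, Matrix.mul_assoc, coin_mul_conjTranspose h]

/-- Expanding the coin in `U² N* = S K S N*` and using `S² = 1` gives the Chebyshev three-term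
recurrence. -/
theorem evolution_sq_mul_conjTranspose (h : ∀ v, G.degree v ≠ 0) :
    evolution G * (evolution G * (boundary G)ᴴ) =
      (2 : ℂ) • (evolution G * (boundary G)ᴴ * discriminant G) - (boundary G)ᴴ := by
  rw [evolution_mul_conjTranspose h, evolution, coin, discriminant]
  rw [Matrix.mul_sub, Matrix.sub_mul, Matrix.mul_one, ← Matrix.mul_assoc (shift G) (shift G),
    shift_mul_shift, Matrix.one_mul, Matrix.mul_smul, Matrix.smul_mul]
  simp only [Matrix.mul_assoc]

/-- The Grover walk compressed to the vertex space is a Chebyshev polynomial in the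
discriminant. -/
theorem boundary_mul_evolution_pow (h : ∀ v, G.degree v ≠ 0) (n : ℕ) :
    boundary G * (evolution G ^ n * (boundary G)ᴴ) =
      aeval (discriminant G) (Chebyshev.T ℂ n) := by
  induction n using Nat.twoStepInduction with
  | zero => simp [boundary_mul_conjTranspose G h]
  | one => simp [evolution_mul_conjTranspose h, discriminant, Matrix.mul_assoc]
  | more n ih0 ih1 =>
    have hT : Chebyshev.T ℂ ((n + 2 : ℕ) : ℤ) =
        Chebyshev.T ℂ ((n + 1 : ℕ) : ℤ) * (C 2 * X) - Chebyshev.T ℂ (n : ℤ) := by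
      have h := Chebyshev.T_add_two ℂ (n : ℤ)
      push_cast
      rw [h, map_ofNat]
      ring
    rw [hT, map_sub, map_mul, ← ih0, ← ih1, pow_add, pow_two, Matrix.mul_assoc, Matrix.mul_assoc,
      evolution_sq_mul_conjTranspose h, Matrix.mul_sub, Matrix.mul_sub, pow_succ]
    simp [Matrix.mul_assoc, Matrix.mul_smul, Algebra.algebraMap_eq_smul_one]

/-- `Y = U^n N*` is an isometry. If its compression `Q` is one too, nothing leaves the range of
`N*`: the Gram matrix of `Y - N* Q` is `1 - Q*Q = 0`. -/
theorem evolution_pow_mul_eq_of_compression (h : ∀ v, G.degree v ≠ 0) (n : ℕ) {Q : Matrix V V ℂ}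
    (hQ : Qᴴ * Q = 1) (hn : boundary G * (evolution G ^ n * (boundary G)ᴴ) = Q) :
    evolution G ^ n * (boundary G)ᴴ = (boundary G)ᴴ * Q := by
  have hX : (evolution G ^ n * (boundary G)ᴴ)ᴴ * (evolution G ^ n * (boundary G)ᴴ) = 1 := by
    rw [Matrix.conjTranspose_mul, Matrix.mul_assoc, ← Matrix.mul_assoc _ᴴ (evolution G ^ n),
      evolution_pow_conjTranspose_mul h, Matrix.one_mul, Matrix.conjTranspose_conjTranspose,
      boundary_mul_conjTranspose G h]
  have hn' : (evolution G ^ n * (boundary G)ᴴ)ᴴ * (boundary G)ᴴ = Qᴴ := by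
    rw [← Matrix.conjTranspose_mul, hn]
  generalize evolution G ^ n * (boundary G)ᴴ = Y at *
  rw [← sub_eq_zero, ← Matrix.conjTranspose_mul_self_eq_zero, Matrix.conjTranspose_sub,
    Matrix.conjTranspose_mul, Matrix.conjTranspose_conjTranspose, Matrix.sub_mul, Matrix.mul_sub,
    Matrix.mul_sub, hX, ← Matrix.mul_assoc, hn', hQ, Matrix.mul_assoc, hn, hQ, Matrix.mul_assoc,
    ← Matrix.mul_assoc (boundary G), boundary_mul_conjTranspose G h, Matrix.one_mul, hQ]
  simp

theorem aeval_discriminant_apply_of_pst (h : ∀ v, G.degree v ≠ 0) {u v : V} {n : ℕ} {γ : ℂ}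
    (hγ : (evolution G ^ n) *ᵥ vertexState G u = γ • vertexState G v) (w : V) :
    aeval (discriminant G) (Chebyshev.T ℂ n) w u = if w = v then γ else 0 := by
  have h2 := congrArg (fun x => (boundary G *ᵥ x) w) hγ
  simp only [vertexState, Matrix.mulVec_smul, Matrix.mulVec_mulVec,
    boundary_mul_evolution_pow h, boundary_mul_conjTranspose G h] at h2
  simpa [Matrix.one_apply] using h2

theorem pstBetween_of_aeval_discriminant (h : ∀ v, G.degree v ≠ 0) {Q : Matrix V V ℂ} {n : ℕ}
    (hn : 0 < n) (hQ : Qᴴ * Q = 1) (hT : aeval (discriminant G) (Chebyshev.T ℂ n) = Q)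
    {u v : V} (huv : u ≠ v) (hQu : Q *ᵥ Pi.single u 1 = Pi.single v 1) :
    PSTBetween G u v n := by
  refine ⟨huv, hn, 1, by simp, ?_⟩
  rw [vertexState, vertexState, Matrix.mulVec_mulVec,
    evolution_pow_mul_eq_of_compression h n hQ (by rw [boundary_mul_evolution_pow h, hT]),
    ← Matrix.mulVec_mulVec, hQu, one_smul]

theorem _root_.Matrix.aeval_mulVec_of_eigenvector {P : Matrix V V ℂ} {c : ℂ} {x : V → ℂ}
    (hx : P *ᵥ x = c • x) (p : ℂ[X]) : aeval P p *ᵥ x = p.eval c • x := by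
  induction p using Polynomial.induction_on with
  | C a => simp [Algebra.algebraMap_eq_smul_one, Matrix.smul_mulVec]
  | add p q hp hq => simp only [map_add, Matrix.add_mulVec, hp, hq, eval_add, add_smul]
  | monomial n a ih =>
    rw [pow_succ, ← mul_assoc, map_mul, aeval_X, ← Matrix.mulVec_mulVec, hx, Matrix.mulVec_smul, ih,
      smul_smul, eval_mul (q := X), eval_X, mul_comm c]

end Walk

/-! ### Polynomials in the discriminant of a distance-regular graph -/

section DistanceRegular

variable {V : Type*} [Fintype V] {G : SimpleGraph V}

theorem IsDistanceRegular.sum_eq (hG : IsDistanceRegular G) {M : Type*} [AddCommMonoid M]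
    (g : ℕ × ℕ → M) {u v u' v' : V} (h : G.dist u v = G.dist u' v') :
    ∑ x, g (G.dist u x, G.dist v x) = ∑ x, g (G.dist u' x, G.dist v' x) := by
  classical
  have key : (Finset.univ : Finset V).val.map (fun x => (G.dist u x, G.dist v x)) =
      (Finset.univ : Finset V).val.map (fun x => (G.dist u' x, G.dist v' x)) := by
    ext ⟨i, j⟩
    have := hG.2 i j u v u' v' h
    simp only [Finset.card_def, Finset.filter_val] at this
    simpa [Multiset.count_map, eq_comm] using this
  have := congrArg (fun m => (m.map g).sum) key
  simp only [Multiset.map_map, Function.comp_def] at this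
  exact this

theorem IsDistanceRegular.card_dist_eq (hG : IsDistanceRegular G) (i : ℕ) (u v : V) :
    (Finset.univ.filter fun w => G.dist u w = i).card =
      (Finset.univ.filter fun w => G.dist v w = i).card := by
  simpa using hG.2 i i u u v v (by simp)

variable [DecidableEq V] [DecidableRel G.Adj]

omit [DecidableEq V] in
theorem degree_eq_card_dist (v : V) :
    G.degree v = (Finset.univ.filter fun w => G.dist v w = 1).card := by
  rw [← G.card_neighborFinset_eq_degree]
  congr 1
  ext w
  simp [SimpleGraph.dist_eq_one_iff_adj]

omit [DecidableEq V] in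
theorem IsDistanceRegular.degree_eq (hG : IsDistanceRegular G) (u v : V) :
    G.degree u = G.degree v := by
  rw [degree_eq_card_dist, degree_eq_card_dist, hG.card_dist_eq]

theorem IsDistanceRegular.aeval_discriminant_apply_eq (hG : IsDistanceRegular G) (p : ℂ[X])
    {u v u' v' : V} (h : G.dist u v = G.dist u' v') :
    aeval (discriminant G) p u v = aeval (discriminant G) p u' v' := by
  induction p using Polynomial.induction_on generalizing u v u' v' with
  | C a =>
    have : u = v ↔ u' = v' := by rw [← hG.1.dist_eq_zero_iff, h, hG.1.dist_eq_zero_iff]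
    simp [Algebra.algebraMap_eq_smul_one, Matrix.one_apply, this]
  | add p q hp hq => simp only [map_add, Matrix.add_apply, hp h, hq h]
  | monomial n a ih =>
    rw [pow_succ, ← mul_assoc, map_mul, aeval_X, Matrix.mul_apply, Matrix.mul_apply]
    generalize aeval (discriminant G) (C a * X ^ n) = M at ih
    -- Both factors are functions of distance, so each product entry is a sum over pairs of
    -- distances, as `sum_eq` requires.
    obtain ⟨f, hf⟩ := (Function.factorsThrough_iff (f := fun p : V × V => G.dist p.1 p.2)
      (fun p : V × V => M p.1 p.2)).1 (fun _ _ h => ih h)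
    have hf' : ∀ x y, M x y = f (G.dist x y) := fun x y => congrFun hf (x, y)
    have hP := discriminant_apply_of_regular G (k := G.degree u) (fun w => hG.degree_eq w u)
    have := hG.sum_eq (fun p => f p.1 * if p.2 = 1 then (G.degree u : ℂ)⁻¹ else 0) h
    simpa only [hf', hP, SimpleGraph.dist_eq_one_iff_adj, G.adj_comm] using this

end DistanceRegular

/-- `G` is a cocktail party graph whose unique non-neighbour map is `σ`. -/
structure IsCocktailParty {V : Type*} (G : SimpleGraph V) (σ : V → V) : Prop where
  involutive : Function.Involutive σ
  ne (x : V) : σ x ≠ x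
  adj_iff (x y : V) : G.Adj x y ↔ y ≠ x ∧ y ≠ σ x

/-! ### Cocktail party graphs -/

namespace IsCocktailParty

section

variable {V W : Type*} {G : SimpleGraph V} {H : SimpleGraph W} {σ : V → V} {ρ : W → W}

theorem of_iso (hH : IsCocktailParty H ρ) (e : G ≃g H) :
    IsCocktailParty G (fun x => e.symm (ρ (e x))) where
  involutive x := by simp [hH.involutive (e x)]
  ne x h := hH.ne (e x) (by rw [← e.apply_symm_apply (ρ (e x)), h])
  adj_iff x y := by
    rw [← e.map_adj_iff, hH.adj_iff, e.injective.ne_iff,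
      ← e.injective.ne_iff (x := y) (y := e.symm _), e.apply_symm_apply]

/-- The pairing of vertices of a cocktail party graph. -/
def setoid (hG : IsCocktailParty G σ) : Setoid V where
  r x y := y = x ∨ y = σ x
  iseqv := by
    refine ⟨fun x => Or.inl rfl, ?_, ?_⟩
    · rintro x y (rfl | rfl)
      · exact Or.inl rfl
      · exact Or.inr (hG.involutive x).symm
    · rintro x y z (rfl | rfl) (rfl | rfl)
      · exact Or.inl rfl
      · exact Or.inr rfl
      · exact Or.inr rfl
      · exact Or.inl (hG.involutive x)

theorem nonempty_iso [Fintype V] (hG : IsCocktailParty G σ) {m : ℕ}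
    (hm : Fintype.card V = m * 2) :
    Nonempty (G ≃g SimpleGraph.completeEquipartiteGraph m 2) := by
  classical
  let Q := Quotient hG.setoid
  have hfib : ∀ q : Q, Nonempty ({x : V // (Quotient.mk hG.setoid x) = q} ≃ Fin 2) := by
    intro q
    induction q using Quotient.inductionOn with | _ a
    refine ⟨Fintype.equivFinOfCardEq ?_⟩
    rw [Fintype.card_subtype]
    have : (Finset.univ.filter fun x => Quotient.mk hG.setoid x = Quotient.mk hG.setoid a) =
        {a, σ a} := by
      ext x
      rw [Finset.mem_filter, eq_comm, Quotient.eq]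
      simp only [Finset.mem_univ, true_and, Finset.mem_insert, Finset.mem_singleton]
      exact Iff.rfl
    rw [this, Finset.card_pair (hG.ne a).symm]
  let e₁ : V ≃ Q × Fin 2 := (Equiv.sigmaFiberEquiv (Quotient.mk hG.setoid)).symm.trans
    ((Equiv.sigmaCongrRight fun q => (hfib q).some).trans (Equiv.sigmaEquivProd Q (Fin 2)))
  have he₁ : ∀ x, (e₁ x).1 = Quotient.mk hG.setoid x := fun x => rfl
  have hQ : Fintype.card Q = m := by
    have := Fintype.card_congr e₁
    rw [Fintype.card_prod, Fintype.card_fin, hm] at this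
    omega
  let e₂ : V ≃ Fin m × Fin 2 :=
    e₁.trans (Equiv.prodCongr (Fintype.equivFinOfCardEq hQ) (Equiv.refl _))
  refine ⟨⟨e₂, ?_⟩⟩
  intro a b
  have : (e₂ a).1 = (e₂ b).1 ↔ b = a ∨ b = σ a := by
    simp only [e₂, Equiv.trans_apply, Equiv.prodCongr_apply, Prod.map_fst,
      (Fintype.equivFinOfCardEq hQ).injective.eq_iff, he₁]
    rw [Quotient.eq]
    exact Iff.rfl
  rw [SimpleGraph.completeEquipartiteGraph_adj, Ne, this, hG.adj_iff, not_or]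

end

theorem completeEquipartiteGraph_two (m : ℕ) :
    IsCocktailParty (SimpleGraph.completeEquipartiteGraph m 2) (fun x => (x.1, x.2 + 1)) where
  involutive := by
    rintro ⟨i, j⟩
    fin_cases j <;> rfl
  ne := by
    rintro ⟨i, j⟩
    fin_cases j <;> simp
  adj_iff := by
    rintro ⟨i, j⟩ ⟨i', j'⟩
    rw [SimpleGraph.completeEquipartiteGraph_adj]
    fin_cases j <;> fin_cases j' <;> simp [eq_comm]

theorem cycleGraph_four : IsCocktailParty (SimpleGraph.cycleGraph 4) (fun x => x + 2) where
  involutive := by unfold Function.Involutive; decide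
  ne := by decide
  adj_iff := by decide

variable {V : Type*} [Fintype V] [DecidableEq V] {G : SimpleGraph V} [DecidableRel G.Adj]
  {σ : V → V}

theorem degree_add_two (hG : IsCocktailParty G σ) (v : V) :
    G.degree v + 2 = Fintype.card V := by
  have h : (G.neighborFinset v)ᶜ = {v, σ v} := by
    ext w
    simp [hG.adj_iff]
    tauto
  have := Finset.card_compl_add_card (G.neighborFinset v)
  rw [h, Finset.card_pair (hG.ne v).symm, G.card_neighborFinset_eq_degree] at this
  omega

theorem discriminant_mulVec (hG : IsCocktailParty G σ) {k : ℕ} (hk : ∀ v, G.degree v = k)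
    (g : V → ℂ) (x : V) :
    (discriminant G *ᵥ g) x = (k : ℂ)⁻¹ * (∑ y, g y - g x - g (σ x)) := by
  have h : ∀ y, discriminant G x y * g y =
      (k : ℂ)⁻¹ * (g y - (if y = x then g y else 0) - (if y = σ x then g y else 0)) := by
    intro y
    rw [discriminant_apply_of_regular G hk]
    simp only [hG.adj_iff]
    by_cases h1 : y = x
    · subst h1
      simp [(hG.ne y).symm]
    · by_cases h2 : y = σ x <;> simp [h1, h2, hG.ne]
  simp only [Matrix.mulVec, dotProduct, h, ← Finset.mul_sum, Finset.sum_sub_distrib]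
  simp

/-- The permutation matrix of the pairing. -/
def pairing (σ : V → V) : Matrix V V ℂ := Matrix.of fun x y => if y = σ x then 1 else 0

theorem pairing_mulVec (g : V → ℂ) : pairing σ *ᵥ g = g ∘ σ := by
  ext x
  simp [pairing, Matrix.mulVec, dotProduct]

theorem discriminant_mul_pairing (hG : IsCocktailParty G σ) {k : ℕ} (hk : ∀ v, G.degree v = k) :
    discriminant G * pairing σ = discriminant G := by
  refine Matrix.ext_of_mulVec_single fun i => ?_
  rw [← Matrix.mulVec_mulVec, pairing_mulVec]
  ext x
  rw [hG.discriminant_mulVec hk, hG.discriminant_mulVec hk]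
  simp only [Function.comp, hG.involutive x, hG.involutive.bijective.sum_comp]
  ring

/-- With `J` the all-ones matrix and `R` the pairing, `k P = J - 1 - R`, where `J² = (k + 2) J`, `J
R = R J = J` and `R² = 1`. -/
theorem discriminant_mul_self (hG : IsCocktailParty G σ) {k : ℕ} (hk : ∀ v, G.degree v = k)
    (h0 : k ≠ 0) :
    discriminant G * discriminant G =
      (k : ℂ)⁻¹ • (((k : ℂ) - 2) • discriminant G + 1 + pairing σ) := by
  have hc : (k : ℂ) ≠ 0 := by exact_mod_cast h0
  refine Matrix.ext_of_mulVec_single fun i => ?_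
  generalize (Pi.single i 1 : V → ℂ) = g
  rw [← Matrix.mulVec_mulVec]
  ext x
  have hcard : (Fintype.card V : ℂ) = k + 2 := by
    rw [← hG.degree_add_two x, hk]; push_cast; rfl
  rw [hG.discriminant_mulVec hk]
  simp only [hG.discriminant_mulVec hk, ← Finset.mul_sum, Finset.sum_sub_distrib,
    hG.involutive.bijective.sum_comp, hG.involutive x, Matrix.smul_mulVec, Matrix.add_mulVec,
    Pi.smul_apply, Pi.add_apply, Matrix.one_mulVec, pairing_mulVec, Function.comp, smul_eq_mul,
    Finset.sum_const, Finset.card_univ, nsmul_eq_mul, hcard]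
  field_simp
  ring

theorem pairing_conjTranspose_mul (hσ : Function.Involutive σ) :
    (pairing σ)ᴴ * pairing σ = 1 := by
  have h : (pairing σ)ᴴ = pairing σ := by
    ext x y
    simp only [pairing, Matrix.conjTranspose_apply, Matrix.of_apply, eq_comm (a := x),
      hσ.eq_iff]
    split_ifs <;> simp
  rw [h]
  refine Matrix.ext_of_mulVec_single fun i => ?_
  rw [← Matrix.mulVec_mulVec, pairing_mulVec, pairing_mulVec, Matrix.one_mulVec]
  ext x
  simp [hσ x]

theorem hasPST_of_aeval_eq_pairing [Nonempty V] (hG : IsCocktailParty G σ)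
    (hd : ∀ v, G.degree v ≠ 0) {n : ℕ} (hn : 0 < n)
    (h : aeval (discriminant G) (Chebyshev.T ℂ n) = pairing σ) : HasPST G := by
  obtain ⟨u⟩ := ‹Nonempty V›
  refine ⟨u, σ u, n, pstBetween_of_aeval_discriminant hd hn
    (pairing_conjTranspose_mul hG.involutive) h (hG.ne u).symm ?_⟩
  ext x
  rw [pairing_mulVec, Function.comp]
  simp only [Pi.single_apply, hG.involutive.eq_iff]

theorem aeval_T_add_two (P : Matrix V V ℂ) (n : ℕ) :
    aeval P (Chebyshev.T ℂ ((n + 2 : ℕ) : ℤ)) =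
      (2 : ℂ) • (P * aeval P (Chebyshev.T ℂ ((n + 1 : ℕ) : ℤ))) -
        aeval P (Chebyshev.T ℂ (n : ℤ)) := by
  push_cast
  rw [Chebyshev.T_add_two, map_sub, map_mul, map_mul, aeval_X, map_ofNat, two_smul, mul_assoc,
    two_mul]

theorem hasPST_of_card_eq_four (hG : IsCocktailParty G σ) (h : Fintype.card V = 4) :
    HasPST G := by
  have hk : ∀ v, G.degree v = 2 := fun v => by have := hG.degree_add_two v; omega
  have : Nonempty V := Fintype.card_pos_iff.1 (by omega)
  refine hG.hasPST_of_aeval_eq_pairing (fun v => by simp [hk]) two_pos ?_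
  rw [show (2 : ℕ) = 0 + 2 from rfl, aeval_T_add_two _ 0]
  simp [hG.discriminant_mul_self hk]

/-- The eigenvalues 1, 0, -1/2 of `P` are cosines of 0, `π/2`, `2π/3`, so `T_6` sends them to 1, -1,
1, the matching eigenvalues of the pairing. The computation runs the recurrence in the span of `1`,
`P`, `S`, where `S` here denotes the pairing. -/
theorem hasPST_of_card_eq_six (hG : IsCocktailParty G σ) (h : Fintype.card V = 6) :
    HasPST G := by
  have hk : ∀ v, G.degree v = 4 := fun v => by have := hG.degree_add_two v; omega
  have : Nonempty V := Fintype.card_pos_iff.1 (by omega)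
  refine hG.hasPST_of_aeval_eq_pairing (fun v => by simp [hk]) (by norm_num : 0 < 6) ?_
  have hPP := hG.discriminant_mul_self hk four_ne_zero
  have hPS := hG.discriminant_mul_pairing hk
  generalize discriminant G = P at *
  generalize pairing σ = S at *
  have h0 : aeval P (Chebyshev.T ℂ ((0 : ℕ) : ℤ)) = 1 := by simp
  have h1 : aeval P (Chebyshev.T ℂ ((1 : ℕ) : ℤ)) = P := by simp
  have h2 : aeval P (Chebyshev.T ℂ ((2 : ℕ) : ℤ)) = P + (2⁻¹ : ℂ) • S - (2⁻¹ : ℂ) • 1 := by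
    rw [aeval_T_add_two P 0, h0, h1, hPP]
    push_cast
    module
  have h3 : aeval P (Chebyshev.T ℂ ((3 : ℕ) : ℤ)) = (2⁻¹ : ℂ) • S + (2⁻¹ : ℂ) • 1 := by
    rw [aeval_T_add_two P 1, h1, h2]
    simp only [mul_add, mul_sub, mul_smul_comm, hPP, hPS, mul_one]
    push_cast
    module
  have h4 : aeval P (Chebyshev.T ℂ ((4 : ℕ) : ℤ)) = P - (2⁻¹ : ℂ) • S + (2⁻¹ : ℂ) • 1 := by
    rw [aeval_T_add_two P 2, h2, h3]
    simp only [mul_add, mul_smul_comm, hPS, mul_one]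
    module
  have h5 : aeval P (Chebyshev.T ℂ ((5 : ℕ) : ℤ)) = P := by
    rw [aeval_T_add_two P 3, h3, h4]
    simp only [mul_add, mul_sub, mul_smul_comm, hPP, hPS, mul_one]
    push_cast
    module
  rw [aeval_T_add_two P 4, h4, h5, hPP]
  push_cast
  module

/-- A Chebyshev polynomial in the discriminant of a cocktail party graph that is a multiple of the
pairing fixes both `1` and the least eigenvalue `-2 / k`. -/
theorem eval_T_eq_one (hG : IsCocktailParty G σ) {k : ℕ} (hk : ∀ v, G.degree v = k)
    {u w : V} (huw : G.Adj u w) {n : ℕ} {γ : ℂ}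
    (hM : aeval (discriminant G) (Chebyshev.T ℂ n) = γ • pairing σ) :
    (Chebyshev.T ℂ n).eval (-2 / k : ℂ) = 1 := by
  have hk0 : (k : ℂ) ≠ 0 := by
    rw [← hk u]
    exact_mod_cast (G.degree_pos_iff_exists_adj u).2 ⟨w, huw⟩ |>.ne'
  have hcard : (Fintype.card V : ℂ) = k + 2 := by
    rw [← hG.degree_add_two u, hk]; push_cast; rfl
  have hγ : γ = 1 := by
    have h1 : discriminant G *ᵥ (fun _ => 1) = (1 : ℂ) • (fun _ : V => (1 : ℂ)) := by
      ext x
      rw [hG.discriminant_mulVec hk]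
      simp [hcard]
      field_simp
      ring
    have := congrFun (Matrix.aeval_mulVec_of_eigenvector h1 (Chebyshev.T ℂ n)) u
    rw [hM, Matrix.smul_mulVec, pairing_mulVec] at this
    simpa using this
  obtain ⟨hwu, hwsu⟩ := (hG.adj_iff u w).1 huw
  -- A difference of indicators of two pairs is `σ`-invariant with sum zero, hence a `-2/k`
  -- eigenvector; adjacency of `u` and `w` makes the pairs disjoint.
  let f : V → V → ℂ := fun a => Pi.single a 1 + Pi.single (σ a) 1
  have hf : ∀ a, f a ∘ σ = f a := fun a => by
    ext x
    simp only [f, Function.comp, Pi.add_apply, Pi.single_apply, hG.involutive.injective.eq_iff,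
      hG.involutive.eq_iff]
    ring
  let g : V → ℂ := f u - f w
  have hgσ : ∀ x, g (σ x) = g x := fun x => by
    have h1 := congrFun (hf u) x
    have h2 := congrFun (hf w) x
    simp only [Function.comp] at h1 h2
    simp only [g, Pi.sub_apply, h1, h2]
  have hsum : ∑ y, g y = 0 := by
    simp [g, f, Finset.sum_add_distrib]
  have hP : discriminant G *ᵥ g = (-2 / k : ℂ) • g := by
    ext x
    rw [hG.discriminant_mulVec hk, hsum, hgσ, Pi.smul_apply, smul_eq_mul]
    field_simp
    ring
  have hgu : g u = 1 := by
    have : u ≠ σ w := fun h => hwsu (by rw [h, hG.involutive])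
    simp [g, f, hwu.symm, (hG.ne u).symm, this]
  have := congrFun (Matrix.aeval_mulVec_of_eigenvector hP (Chebyshev.T ℂ n)) u
  rw [hM, hγ, one_smul, pairing_mulVec, Function.comp, hgσ, Pi.smul_apply, hgu] at this
  simpa using this.symm

end IsCocktailParty

/-- By Niven's theorem, a Chebyshev polynomial takes the value `1` at `-2 / k` only if `k` is `2`
or `4`. -/
theorem eq_two_or_four_of_eval_T {k n : ℕ} (hk : 2 ≤ k) (hn : 0 < n)
    (h : (Chebyshev.T ℂ n).eval (-2 / k : ℂ) = 1) : k = 2 ∨ k = 4 := by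
  have hk' : (2 : ℝ) ≤ k := by exact_mod_cast hk
  have hk0 : (0 : ℝ) < k := by linarith
  have hcos : Real.cos (Real.arccos (-2 / k)) = -2 / k := by
    apply Real.cos_arccos
    · rw [le_div_iff₀ hk0]; linarith
    · rw [div_le_iff₀ hk0]; linarith
  have h1 : Real.cos (n * Real.arccos (-2 / k)) = 1 := by
    have h2 : (-2 / k : ℂ) = Complex.cos (Real.arccos (-2 / k) : ℝ) := by
      rw [← Complex.ofReal_cos, hcos]; push_cast; rfl
    rw [h2, Chebyshev.T_complex_cos] at h
    exact_mod_cast h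
  obtain ⟨m, hm⟩ := (Real.cos_eq_one_iff _).1 h1
  have hn0 : (n : ℝ) ≠ 0 := by exact_mod_cast hn.ne'
  have hniven := niven (θ := Real.arccos (-2 / k))
    ⟨2 * m / n, by
      push_cast
      rw [div_mul_eq_mul_div, eq_div_iff hn0]
      linarith⟩ ⟨-2 / k, by rw [hcos]; push_cast; rfl⟩
  rw [hcos] at hniven
  simp only [Set.mem_insert_iff, Set.mem_singleton_iff] at hniven
  -- Of Niven's values only -1 and -1/2 are negative.
  have hneg : (-2 / k : ℝ) < 0 := div_neg_of_neg_of_pos (by norm_num) hk0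
  rcases hniven with h | h | h | h | h
  · left
    rw [div_eq_iff hk0.ne'] at h
    exact_mod_cast (by linarith : (k : ℝ) = 2)
  · right
    rw [div_eq_iff hk0.ne'] at h
    exact_mod_cast (by linarith : (k : ℝ) = 4)
  all_goals linarith

/-! ### From a unique vertex at distance two to a cocktail party graph -/

section Antipodal

variable {V : Type*} [Fintype V] {G : SimpleGraph V}

/-- A distance-regular graph of diameter two in which some vertex has exactly one vertex at
distance two is a cocktail party graph. -/
theorem IsDistanceRegular.exists_isCocktailParty (hG : IsDistanceRegular G)
    (hle : ∀ x y, G.dist x y ≤ 2) {u v : V} (huv : G.dist u v = 2)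
    (huniq : ∀ w, G.dist u w = 2 → w = v) :
    ∃ σ : V → V, IsCocktailParty G σ ∧ ∀ x y, y = σ x ↔ G.dist x y = 2 := by
  classical
  have h1 : ∀ x, ∃ z, ∀ y, G.dist x y = 2 ↔ y = z := by
    intro x
    have hu : (Finset.univ.filter fun w => G.dist u w = 2) = {v} := by
      ext w
      simp only [Finset.mem_filter, Finset.mem_univ, true_and, Finset.mem_singleton]
      exact ⟨huniq w, fun h => h ▸ huv⟩
    have hx := hG.card_dist_eq 2 x u
    rw [hu, Finset.card_singleton, Finset.card_eq_one] at hx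
    obtain ⟨z, hz⟩ := hx
    refine ⟨z, fun y => ?_⟩
    simpa using Finset.ext_iff.1 hz y
  choose σ hσ using h1
  refine ⟨σ, ⟨fun x => ?_, fun x hx => ?_, fun x y => ?_⟩, fun x y => (hσ x y).symm⟩
  · rw [eq_comm, ← hσ, SimpleGraph.dist_comm, hσ]
  · have := (hσ x x).2 hx.symm
    simp at this
  · rw [← SimpleGraph.dist_eq_one_iff_adj, Ne, Ne, ← hσ, eq_comm (a := y),
      ← hG.1.dist_eq_zero_iff]
    have := hle x y
    omega

end Antipodal

end GroverWalk

open GroverWalk in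
theorem theorem4p5 {V : Type*} [Fintype V] [DecidableEq V] (G : SimpleGraph V)
    [DecidableRel G.Adj] (hG : GroverWalk.IsDistanceRegular G) (hd : G.diam = 2) :
    GroverWalk.HasPST G ↔
      Nonempty (G ≃g SimpleGraph.cycleGraph 4) ∨
        Nonempty (G ≃g SimpleGraph.completeEquipartiteGraph 3 2) := by
  constructor
  · rintro ⟨u, v, n, huv, hn, γ, hγ, hU⟩
    have hle : ∀ x y, G.dist x y ≤ 2 := fun x y => hd ▸ SimpleGraph.dist_le_diam
      (SimpleGraph.ediam_ne_top_of_diam_ne_zero (by omega))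
    have : Nonempty V := ⟨u⟩
    obtain ⟨a, b, hab⟩ := G.exists_dist_eq_diam
    rw [hd] at hab
    obtain ⟨p, hp⟩ := hG.1.exists_walk_length_eq_dist a b
    rw [hab] at hp
    obtain ⟨c, hac, hcb⟩ : ∃ c, G.Adj a c ∧ G.Adj c b := by
      match p, hp with
      | .cons h1 (.cons h2 .nil), _ => exact ⟨_, h1, h2⟩
    have hne : a ≠ b := by rintro rfl; simp at hab
    -- The midpoint `c` of a geodesic of length 2 has two distinct neighbours, and `G` is regular.
    have hdeg2 : ∀ x, 2 ≤ G.degree x := by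
      intro x
      rw [hG.degree_eq x c, ← G.card_neighborFinset_eq_degree, ← Finset.card_pair hne]
      refine Finset.card_le_card fun y hy => ?_
      rcases Finset.mem_insert.1 hy with rfl | hy
      · simpa using hac.symm
      · rw [Finset.mem_singleton] at hy; subst hy; simpa using hcb
    have hdeg : ∀ x, G.degree x ≠ 0 := fun x => by have := hdeg2 x; omega
    have hM := aeval_discriminant_apply_of_pst hdeg hU
    have hγ0 : γ ≠ 0 := by rintro rfl; simp at hγ
    have huniq : ∀ w, G.dist u w = G.dist u v → w = v := by
      intro w hw
      by_contra hwv
      have := hG.aeval_discriminant_apply_eq (Chebyshev.T ℂ n) (u := w) (v := u) (u' := v) (v' := u)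
        (by rw [G.dist_comm, hw, G.dist_comm])
      rw [hM, hM, if_neg hwv, if_pos rfl] at this
      exact hγ0 this.symm
    have hdist : G.dist u v = 2 := by
      have h1 := hG.1.pos_dist_of_ne huv
      have h2 := hle u v
      by_contra h3
      have h4 : G.dist u v = 1 := by omega
      have h5 := hdeg2 u
      rw [degree_eq_card_dist] at h5
      have : (Finset.univ.filter fun w => G.dist u w = 1) ⊆ {v} := by
        intro w hw
        rw [Finset.mem_filter] at hw
        simpa using huniq w (by rw [hw.2, h4])
      have := Finset.card_le_card this
      rw [Finset.card_singleton] at this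
      omega
    rw [hdist] at huniq
    obtain ⟨σ, hσ, hσd⟩ := hG.exists_isCocktailParty hle hdist huniq
    obtain ⟨w, huw⟩ := (G.degree_pos_iff_exists_adj u).1 (Nat.pos_of_ne_zero (hdeg u))
    -- Column `u` meets all three distances, so it determines the whole matrix.
    have hMσ : aeval (discriminant G) (Chebyshev.T ℂ n) = γ • IsCocktailParty.pairing σ := by
      ext x y
      simp only [Matrix.smul_apply, IsCocktailParty.pairing, Matrix.of_apply, hσd]
      have h2 := hle x y
      interval_cases h : G.dist x y
      · rw [hG.aeval_discriminant_apply_eq _ (u' := u) (v' := u) (by simpa using h), hM]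
        simp [huv]
      · have hwu := SimpleGraph.dist_eq_one_iff_adj.2 huw.symm
        rw [hG.aeval_discriminant_apply_eq _ (u' := w) (v' := u) (by rw [h, hwu]), hM]
        have : w ≠ v := by rintro rfl; rw [G.dist_comm] at hwu; omega
        simp [this]
      · rw [hG.aeval_discriminant_apply_eq _ (u' := v) (v' := u) (by rw [h, G.dist_comm, hdist]),
          hM]
        simp
    have hk : ∀ x, G.degree x = G.degree u := fun x => hG.degree_eq x u
    have hcard := hσ.degree_add_two u
    rcases eq_two_or_four_of_eval_T (hdeg2 u) hn (hσ.eval_T_eq_one hk huw hMσ) with h | h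
    · left
      obtain ⟨e⟩ := hσ.nonempty_iso (m := 2) (by omega)
      obtain ⟨e'⟩ := IsCocktailParty.cycleGraph_four.nonempty_iso (m := 2) (by simp)
      exact ⟨e.trans e'.symm⟩
    · right
      exact hσ.nonempty_iso (by omega)
  · rintro (⟨⟨e⟩⟩ | ⟨⟨e⟩⟩)
    · exact (IsCocktailParty.cycleGraph_four.of_iso e).hasPST_of_card_eq_four
        (by simpa using Fintype.card_congr e.toEquiv)
    · exact ((IsCocktailParty.completeEquipartiteGraph_two 3).of_iso e).hasPST_of_card_eq_six
        (by simpa using Fintype.card_congr e.toEquiv)
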